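/- Let $G=(S,T,E)$ be a finite bipartite graph with vertex set $V=S\sqcup T$, and let every edge $e\in E$ have a weight $w(e)>0$. For a matching $M$ of $G$ let $V(M)$ be the set of vertices covered by $M$, let $B(M)=V(M)\,\Delta\,S$ (symmetric difference), and let $w(M)=\prod_{e\in M}w(e)$. Let $M$ be a random matching of $G$ whose distribution is given by probabilities proportional to the weights $w(M)$. Let $V_+$ and $V_-$ be disjoint subsets of $V$ such that at least one matching $M$ of $G$ satisfies $V_+\subseteq B(M)$ and $V_-\cap B(M)=\emptyset$. Let $M'$ have the distribution of $M$ conditioned on the event that $V_+\subseteq B(M)$ and $V_-\cap B(M)=\emptyset$. Put $V'=V\setminus(V_+\cup V_-)$ and $B'(M')=B(M')\cap V'$, a random subset of $V'$. Then $B'(M')$ satisfies the BK inequality for increasing events: for all upward closed families $\mathcal A,\mathcal B\subseteq 2^{V'}$, \[\mathbb P\big(B'(M')\in\mathcal A\,\square\,\mathcal B\big)\le \mathbb P\big(B'(M')\in\mathcal A\big)\,\mathbb P\big(B'(M')\in\mathcal B\big),\] where $\mathcal A\,\square\,\mathcal B=\{A\cup B : A\in\mathcal A,\ B\in\mathcal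 B,\ A\cap B=\emptyset\}$. -/

import Mathlib

open scoped symmDiff ENNReal

noncomputable section

/-- For events `𝒜`, `ℬ` in the power set of `U`: the sets `A ∪ B` with `A ∈ 𝒜`, `B ∈ ℬ` and
`A ∩ B = ∅`; the event that `𝒜` and `ℬ` occur disjointly. -/
def disjointOccurrence {U : Type*} (𝒜 ℬ : Set (Set U)) : Set (Set U) :=
  {C | ∃ A ∈ 𝒜, ∃ B ∈ ℬ, A ∩ B = ∅ ∧ C = A ∪ B}

/-- The random subset of `U` with law `p` satisfies the BK inequality for increasing events.
Here `p.toOuterMeasure 𝒜` is the probability that the random subset belongs to `𝒜`. -/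
def SatisfiesBK {U : Type*} (p : PMF (Set U)) : Prop :=
  ∀ 𝒜 ℬ : Set (Set U), IsUpperSet 𝒜 → IsUpperSet ℬ →
    p.toOuterMeasure (disjointOccurrence 𝒜 ℬ) ≤ p.toOuterMeasure 𝒜 * p.toOuterMeasure ℬ

namespace SimpleGraph

variable {V : Type*} {G : SimpleGraph V}

/-- The matchings of `G`. The vertices of `M : G.Matching` are exactly the covered ones. -/
abbrev Matching (G : SimpleGraph V) : Type _ := {M : G.Subgraph // M.IsMatching}

namespace Matching

/-- `B(M) = V(M) ∆ S`. -/
def B (S : Set V) (M : G.Matching) : Set V := M.1.verts ∆ S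

/-- The weight of a matching: the product of the weights of its edges. -/
def weight [Finite V] (w : Sym2 V → ℝ) (M : G.Matching) : ℝ :=
  ∏ e ∈ (Set.toFinite M.1.edgeSet).toFinset, w e

theorem weight_pos [Finite V] {w : Sym2 V → ℝ} (hw : ∀ e ∈ G.edgeSet, 0 < w e)
    (M : G.Matching) : 0 < M.weight w :=
  Finset.prod_pos fun e he => hw e (M.1.edgeSet_subset ((Set.Finite.mem_toFinset _).1 he))

/-- The empty matching. -/
instance : Inhabited G.Matching := ⟨⟨⊥, fun _ hv => hv.elim⟩⟩

theorem tsum_weight_ne_zero [Finite V] {w : Sym2 V → ℝ} (hw : ∀ e ∈ G.edgeSet, 0 < w e) :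
    ∑' M : G.Matching, ENNReal.ofReal (M.weight w) ≠ 0 := by
  rw [Ne, ENNReal.tsum_eq_zero]
  intro h
  exact (ENNReal.ofReal_pos.2 (weight_pos hw default)).ne' (h default)

theorem tsum_weight_ne_top [Finite V] (w : Sym2 V → ℝ) :
    ∑' M : G.Matching, ENNReal.ofReal (M.weight w) ≠ ∞ := by
  have := Fintype.ofFinite G.Matching
  rw [tsum_fintype]
  exact ENNReal.sum_ne_top.2 fun _ _ => ENNReal.ofReal_ne_top

end Matching

open Matching

/-- The law of the random matching whose probability of being `M` is proportional to the weight
of `M`. -/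
def weightedMatching [Finite V] (G : SimpleGraph V) (w : Sym2 V → ℝ)
    (hw : ∀ e ∈ G.edgeSet, 0 < w e) : PMF G.Matching :=
  PMF.normalize (fun M => ENNReal.ofReal (M.weight w)) (tsum_weight_ne_zero hw)
    (tsum_weight_ne_top w)

/-- The matchings `M` with `V₊ ⊆ B(M)` and `V₋ ∩ B(M) = ∅`. -/
def conditioningEvent (G : SimpleGraph V) (S Vp Vm : Set V) : Set G.Matching :=
  {M | Vp ⊆ M.B S ∧ Vm ∩ M.B S = ∅}

theorem exists_mem_support [Finite V] {w : Sym2 V → ℝ} (hw : ∀ e ∈ G.edgeSet, 0 < w e)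
    {s : Set G.Matching} (hs : s.Nonempty) : ∃ M ∈ s, M ∈ (G.weightedMatching w hw).support := by
  obtain ⟨M, hM⟩ := hs
  refine ⟨M, hM, ?_⟩
  rw [weightedMatching, PMF.mem_support_normalize_iff]
  exact (ENNReal.ofReal_pos.2 (weight_pos hw M)).ne'

/-- The law of `M'`: the weighted random matching conditioned on `V₊ ⊆ B(M)` and
`V₋ ∩ B(M) = ∅`. -/
def conditionedMatching [Finite V] (G : SimpleGraph V) (w : Sym2 V → ℝ)
    (hw : ∀ e ∈ G.edgeSet, 0 < w e) (S Vp Vm : Set V)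
    (hne : (G.conditioningEvent S Vp Vm).Nonempty) : PMF G.Matching :=
  (G.weightedMatching w hw).filter (G.conditioningEvent S Vp Vm) (exists_mem_support hw hne)

/-- `B(M) ∩ V'` as a subset of `V'`. -/
def Matching.restrictB (S V' : Set V) (M : G.Matching) : Set V' := {v | (v : V) ∈ M.B S}

end SimpleGraph

end

/-! Take two independent copies `M`, `N` of the random matching and flip a fair coin for each
component of their union, exchanging the copies there or not. This preserves the joint law: edge
weights only change owner, and the conditioning is a condition at each vertex separately. Given the
pair, a vertex is either in both sets B, in neither, or in exactly one; by `eq_of_reachable_union` a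
component has at most one vertex lying in the first set but not the second. Hence disjoint witnesses
in B of a mixture are forced by disjoint sets of coins, and Reimer's theorem in the form
`card_le_card_inter_flip` bounds the count by that of coin patterns where one event holds for a
mixture and the other for the complementary mixture. Averaging over pairs gives the product. -/

/-! ### Reimer's theorem by linear algebra. -/

section Reimer

open Matrix

variable {ι : Type*} [Fintype ι] [DecidableEq ι]

/-- The matrix whose row `x` is the tensor product over `i` of the basis vector `e_{x i}` if
`i ∈ S x`, and of `2 e_{¬ x i} - e_{x i}` otherwise. -/
def cylinderMatrix (S : (ι → Bool) → Finset ι) : Matrix (ι → Bool) (ι → Bool) ℤ := fun x z =>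
  ∏ i, if i ∈ S x then (if z i = x i then 1 else 0) else (if z i = x i then -1 else 2)

/-- The tensor power of the positive definite matrix `!![2, 1; 1, 2]`. -/
def agreementMatrix (ι : Type*) [Fintype ι] : Matrix (ι → Bool) (ι → Bool) ℤ := fun z z' =>
  ∏ i, if z i = z' i then 2 else 1

/-- Modulo 2 both kinds of factor become the indicator of `z i = x i`, so the matrix reduces to the
identity and its determinant is odd. -/
theorem det_cylinderMatrix_ne_zero (S : (ι → Bool) → Finset ι) : (cylinderMatrix S).det ≠ 0 := by
  have hone : (Int.castRingHom (ZMod 2)).mapMatrix (cylinderMatrix S) = 1 := by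
    ext x z
    rw [RingHom.mapMatrix_apply, Matrix.map_apply, cylinderMatrix, map_prod, Matrix.one_apply]
    have hfac : ∀ i, (Int.castRingHom (ZMod 2)) (if i ∈ S x then (if z i = x i then 1 else 0)
        else (if z i = x i then -1 else 2)) = if z i = x i then 1 else 0 := by
      intro i
      split_ifs <;> rfl
    rw [Finset.prod_congr rfl fun i _ => hfac i, Finset.prod_ite_zero]
    simp only [Finset.mem_univ, true_imp_iff, Finset.prod_const_one, funext_iff, eq_comm]
  intro h
  have := congrArg Matrix.det hone
  rw [← RingHom.map_det, h, map_zero, Matrix.det_one] at this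
  exact zero_ne_one this

theorem cylinderMatrix_eq_zero {S : (ι → Bool) → Finset ι} {x z : ι → Bool}
    (h : ¬ ∀ i ∈ S x, z i = x i) : cylinderMatrix S x z = 0 := by
  push Not at h
  obtain ⟨i, hi, hne⟩ := h
  exact Finset.prod_eq_zero (Finset.mem_univ i) (by rw [if_pos hi, if_neg hne])

/-- The vector `2 e_{¬ x i} - e_{x i}` is orthogonal to `e_{x i}` for the form `!![2, 1; 1, 2]`: the
entry is `2 * 1 - 1 * 2`. -/
theorem cylinderMatrix_mul_agreementMatrix_eq_zero {S : (ι → Bool) → Finset ι} {x z : ι → Bool}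
    (h : ¬ ∀ i ∉ S x, (!z i) = x i) : (cylinderMatrix S * agreementMatrix ι) x z = 0 := by
  push Not at h
  obtain ⟨i, hi, hne⟩ := h
  simp only [Matrix.mul_apply, cylinderMatrix, agreementMatrix, ← Finset.prod_mul_distrib]
  rw [← Fintype.prod_sum fun i b =>
    (if i ∈ S x then (if b = x i then 1 else 0) else (if b = x i then -1 else 2)) *
      (if b = z i then (2 : ℤ) else 1)]
  refine Finset.prod_eq_zero (Finset.mem_univ i) ?_
  rw [Fintype.sum_bool, if_neg hi, if_neg hi]
  revert hne
  cases x i <;> cases z i <;> simp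

theorem agreementMatrix_apply_eq_sum (z z' : ι → Bool) :
    agreementMatrix ι z z' = ∑ t : ι → Option Bool,
      (∏ i, if t i = none ∨ t i = some (z i) then 1 else 0) *
        ∏ i, if t i = none ∨ t i = some (z' i) then 1 else 0 := by
  simp only [← Finset.prod_mul_distrib]
  rw [← Fintype.prod_sum fun i (t : Option Bool) =>
    (if t = none ∨ t = some (z i) then (1 : ℤ) else 0) *
      if t = none ∨ t = some (z' i) then 1 else 0]
  refine Finset.prod_congr rfl fun i _ => ?_
  rw [Fintype.sum_option, Fintype.sum_bool]
  cases z i <;> cases z' i <;> simp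

/-- Each factor is the all-ones matrix (`none`) plus the identity (`some`), so the quadratic form is
a sum of squares, among them every `f z ^ 2`. -/
theorem eq_zero_of_dotProduct_agreementMatrix_eq_zero {f : (ι → Bool) → ℤ}
    (h : f ⬝ᵥ (f ᵥ* agreementMatrix ι) = 0) : f = 0 := by
  set k : (ι → Option Bool) → (ι → Bool) → ℤ := fun t z =>
    ∏ i, if t i = none ∨ t i = some (z i) then 1 else 0
  have hsum : ∑ t, (∑ z, k t z * f z) ^ 2 = 0 := by
    rw [← h]
    simp only [dotProduct, vecMul, agreementMatrix_apply_eq_sum, sq, Finset.mul_sum,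
      Finset.sum_mul]
    rw [Finset.sum_comm]
    refine Finset.sum_congr rfl fun z _ => ?_
    rw [Finset.sum_comm]
    refine Finset.sum_congr rfl fun z' _ => Finset.sum_congr rfl fun t _ => ?_
    simp only [k]
    ring
  rw [Finset.sum_eq_zero_iff_of_nonneg fun _ _ => sq_nonneg _] at hsum
  ext z
  have hz := pow_eq_zero_iff two_ne_zero |>.1 (hsum (fun i => some (z i)) (Finset.mem_univ _))
  rw [Finset.sum_eq_single z] at hz
  · simpa [k] using hz
  · intro z' _ hne
    obtain ⟨i, hi⟩ := Function.ne_iff.1 hne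
    have : k (fun i => some (z i)) z' = 0 :=
      Finset.prod_eq_zero (Finset.mem_univ i) (by simp [Ne.symm hi])
    rw [this, zero_mul]
  · simp

/-- **Reimer's theorem** in its combinatorial form: if the events `A` and `B` occur at each `x ∈ X`
thanks to the coordinates in `S x` and outside `S x` respectively, then `X` has at most as many
elements as the intersection of `A` with the complementary event of `B`. -/
theorem card_le_card_inter_flip (X : Finset (ι → Bool)) (S : (ι → Bool) → Finset ι)
    (A B : (ι → Bool) → Prop) [DecidablePred A] [DecidablePred B]
    (hA : ∀ x ∈ X, ∀ z : ι → Bool, (∀ i ∈ S x, z i = x i) → A z)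
    (hB : ∀ x ∈ X, ∀ z : ι → Bool, (∀ i ∉ S x, z i = x i) → B z) :
    X.card ≤ (Finset.univ.filter fun z : ι → Bool => A z ∧ B fun i => !z i).card := by
  set Z := Finset.univ.filter fun z : ι → Bool => A z ∧ B fun i => !z i with hZ
  let W : Matrix X Z ℤ := (cylinderMatrix S).submatrix (↑) (↑)
  suffices hinj : Function.Injective W.vecMulLinear by
    simpa using card_le_of_injective ℤ W.vecMulLinear hinj
  rw [← LinearMap.ker_eq_bot, LinearMap.ker_eq_bot']
  intro c hc
  let c' : (ι → Bool) → ℤ := fun x => if h : x ∈ X then c ⟨x, h⟩ else 0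
  have hc' : ∀ x, x ∉ X → c' x = 0 := fun x hx => dif_neg hx
  have hvec : ∀ z (hz : z ∈ Z), (c' ᵥ* cylinderMatrix S) z = 0 := by
    intro z hz
    have := congrFun hc ⟨z, hz⟩
    rw [Matrix.vecMulLinear_apply] at this
    rw [← show _ = (0 : ℤ) from this]
    simp only [vecMul, dotProduct, W, Matrix.submatrix_apply]
    rw [← Finset.sum_subset (Finset.subset_univ X), ← Finset.sum_coe_sort X]
    · exact Finset.sum_congr rfl fun x _ => by simp [c']
    · intro x _ hx
      rw [hc' x hx, zero_mul]
  -- At each `z`, the combination `f` of rows vanishes if `z ∈ Z` or `A z` fails, and its image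
  -- under the form vanishes if `B` fails at the flip of `z`. So `f` is isotropic.
  have hzero : c' ᵥ* cylinderMatrix S = 0 := by
    apply eq_zero_of_dotProduct_agreementMatrix_eq_zero
    refine Finset.sum_eq_zero fun z _ => ?_
    by_cases hz : z ∈ Z
    · rw [hvec z hz, zero_mul]
    by_cases hAz : A z
    · have hBz : ¬ B fun i => !z i := fun hBz => hz (by simp [hZ, hAz, hBz])
      rw [Matrix.vecMul_vecMul, mul_eq_zero]
      refine Or.inr (Finset.sum_eq_zero fun x _ => ?_)
      by_cases hx : x ∈ X
      · exact mul_eq_zero_of_right _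
          (cylinderMatrix_mul_agreementMatrix_eq_zero fun h => hBz (hB x hx _ h))
      · rw [hc' x hx, zero_mul]
    · rw [mul_eq_zero]
      refine Or.inl (Finset.sum_eq_zero fun x _ => ?_)
      by_cases hx : x ∈ X
      · exact mul_eq_zero_of_right _ (cylinderMatrix_eq_zero fun h => hAz (hA x hx z h))
      · rw [hc' x hx, zero_mul]
  have hczero := Matrix.eq_zero_of_vecMul_eq_zero (det_cylinderMatrix_ne_zero S) hzero
  ext x
  simpa [c'] using congrFun hczero x

end Reimer

/-! ### Unions and mixtures of two matchings. -/

namespace SimpleGraph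

namespace Matching

variable {V : Type*} {G : SimpleGraph V}

/-- The graph formed by the edges of two matchings. -/
def union (M N : G.Matching) : SimpleGraph V := M.1.spanningCoe ⊔ N.1.spanningCoe

theorem union_adj {M N : G.Matching} {a b : V} :
    (M.union N).Adj a b ↔ M.1.Adj a b ∨ N.1.Adj a b := Iff.rfl

theorem union_comm (M N : G.Matching) : M.union N = N.union M := sup_comm _ _

/-- Two distinct vertices in the same component of the union of two matchings `M`, `N` of a
bipartite graph, each covered by exactly one of the matchings, cannot both belong to `B(M)`:
orienting the edges of `M` from `T` to `S` and those of `N` from `S` to `T`, both would be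
the source of the path that forms this component. -/
theorem eq_of_reachable_union {S T : Set V} (hG : G.IsBipartiteWith S T)
    {M N : G.Matching} {u v : V} (h : (M.union N).Reachable u v)
    (hu : u ∈ M.B S) (huN : u ∉ N.B S) (hv : v ∈ M.B S) (hvN : v ∉ N.B S) : u = v := by
  have hdis : ∀ a, a ∈ S → a ∈ T → False := fun a ha =>
    Set.disjoint_left.1 hG.disjoint ha
  let D : V → V → Prop := fun a b => (a ∈ T ∧ M.1.Adj a b) ∨ (a ∈ S ∧ N.1.Adj a b)
  have hinj : ∀ a b y, D a y → D b y → a = b := by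
    rintro a b y (⟨ha, hay⟩ | ⟨ha, hay⟩) (⟨hb, hby⟩ | ⟨hb, hby⟩)
    · exact M.2.eq_of_adj_right hay hby
    · have h1 := hG.mem_of_adj hay.adj_sub
      have h2 := hG.mem_of_adj hby.adj_sub
      grind
    · have h1 := hG.mem_of_adj hay.adj_sub
      have h2 := hG.mem_of_adj hby.adj_sub
      grind
    · exact N.2.eq_of_adj_right hay hby
  -- Arrows enter S along `M` and T along `N`; such a `y` is missed by `M` if in S and by `N`
  -- otherwise.
  have hsource : ∀ y, y ∈ M.B S → y ∉ N.B S → ∀ a, ¬ D a y := by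
    intro y hy hyN a hay
    simp only [B, Set.mem_symmDiff] at hy hyN
    rcases hay with ⟨ha, hay⟩ | ⟨ha, hay⟩
    · have h1 := hG.mem_of_adj hay.adj_sub
      have h2 := hay.snd_mem
      grind
    · have h1 := hG.mem_of_adj hay.adj_sub
      have h2 := hay.snd_mem
      grind
  have hforward : Relation.ReflTransGen D u v := by
    clear hv hvN
    rw [reachable_iff_reflTransGen] at h
    induction h with
    | refl => exact .refl
    | @tail y z _ hyz ih =>
      have hD : D y z ∨ D z y := by
        rw [union_adj] at hyz
        rcases hyz with hyz | hyz
        · rcases hG.mem_of_adj hyz.adj_sub with h | h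
          · exact Or.inr (Or.inl ⟨h.2, hyz.symm⟩)
          · exact Or.inl (Or.inl ⟨h.1, hyz⟩)
        · rcases hG.mem_of_adj hyz.adj_sub with h | h
          · exact Or.inl (Or.inr ⟨h.1, hyz⟩)
          · exact Or.inr (Or.inr ⟨h.2, hyz.symm⟩)
      -- An edge traversed backwards retraces the last arrow, since at most one arrow enters each
      -- vertex and none enters `u`.
      rcases hD with hD | hD
      · exact ih.tail hD
      · rcases ih.cases_tail with rfl | ⟨y', huy', hy'⟩
        · exact absurd hD (hsource _ hu huN _)
        · rwa [hinj z y' y hD hy']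
  rcases hforward.cases_tail with h | ⟨y, -, hy⟩
  · exact h.symm
  · exact absurd hy (hsource _ hv hvN _)

/-- A chosen vertex in the component of `v` in the graph `H`. -/
noncomputable def root (H : SimpleGraph V) (v : V) : V := (H.connectedComponentMk v).out

theorem root_eq_iff {H : SimpleGraph V} {u v : V} : root H u = root H v ↔ H.Reachable u v := by
  rw [← ConnectedComponent.eq]
  exact (Function.LeftInverse.injective Quot.out_eq).eq_iff

theorem root_eq_of_adj {H : SimpleGraph V} {u v : V} (h : H.Adj u v) : root H u = root H v :=
  root_eq_iff.2 h.reachable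

/-- The matching that agrees with `M` on the components of the union of `M` and `N` whose root is
marked by `x`, and with `N` on the other components. -/
noncomputable def mix (x : V → Bool) (M N : G.Matching) : G.Matching where
  val :=
    { verts := {a | if x (root (M.union N) a) then a ∈ M.1.verts else a ∈ N.1.verts}
      Adj a b := if x (root (M.union N) a) then M.1.Adj a b else N.1.Adj a b
      adj_sub := by
        intro a b h
        split_ifs at h
        exacts [h.adj_sub, h.adj_sub]
      edge_vert := by
        intro a b h
        rw [Set.mem_ofPred_eq]
        split_ifs at h ⊢
        exacts [h.fst_mem, h.fst_mem]
      symm := ⟨fun a b h => by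
        have hab : (M.union N).Adj a b := by
          rw [union_adj]
          split_ifs at h <;> simp [h]
        rw [← root_eq_of_adj hab]
        split_ifs at h ⊢
        exacts [h.symm, h.symm]⟩ }
  property := by
    intro a ha
    rw [Set.mem_ofPred_eq] at ha
    dsimp only
    split_ifs at ha ⊢
    exacts [M.2 ha, N.2 ha]

variable {x : V → Bool} {M N : G.Matching} {a b : V}

theorem mem_verts_mix : a ∈ (mix x M N).1.verts ↔
    if x (root (M.union N) a) then a ∈ M.1.verts else a ∈ N.1.verts := Iff.rfl

theorem mix_adj : (mix x M N).1.Adj a b ↔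
    if x (root (M.union N) a) then M.1.Adj a b else N.1.Adj a b := Iff.rfl

theorem mem_B_mix {S : Set V} : a ∈ (mix x M N).B S ↔
    if x (root (M.union N) a) then a ∈ M.B S else a ∈ N.B S := by
  simp only [B, Set.mem_symmDiff, mem_verts_mix]
  split_ifs <;> rfl

theorem union_mix (x : V → Bool) (M N : G.Matching) :
    (mix x M N).union (mix x N M) = M.union N := by
  ext a b
  simp only [union_adj, mix_adj, union_comm N M]
  split_ifs
  exacts [Iff.rfl, Or.comm]

theorem mix_mix (x : V → Bool) (M N : G.Matching) : mix x (mix x M N) (mix x N M) = M := by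
  apply Subtype.ext
  ext a b
  · rw [mem_verts_mix, mem_verts_mix, mem_verts_mix, union_mix, union_comm N M]
    split_ifs <;> rfl
  · rw [mix_adj, mix_adj, mix_adj, union_mix, union_comm N M]
    split_ifs <;> rfl

theorem mix_swap (x : V → Bool) (M N : G.Matching) : mix x N M = mix (fun v => !x v) M N := by
  apply Subtype.ext
  ext a b
  · rw [mem_verts_mix, mem_verts_mix, union_comm N M]
    cases x (root (M.union N) a) <;> simp
  · rw [mix_adj, mix_adj, union_comm N M]
    cases x (root (M.union N) a) <;> simp

/-- The involution of pairs of matchings that exchanges the two matchings on the components whose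
root is not marked by `x`. -/
noncomputable def mixEquiv (x : V → Bool) : G.Matching × G.Matching ≃ G.Matching × G.Matching :=
  Function.Involutive.toPerm (fun p => (mix x p.1 p.2, mix x p.2 p.1)) fun p => by
    simp only [mix_mix]

theorem weight_eq_prod [Fintype V] [DecidableEq V] (w : Sym2 V → ℝ) (M : G.Matching) :
    M.weight w = ∏ e : Sym2 V, open Classical in if e ∈ M.1.edgeSet then w e else 1 := by
  classical
  rw [weight, ← Finset.prod_filter]
  exact Finset.prod_congr (by ext; simp) fun _ _ => rfl

theorem weight_mix_mul [Finite V] (w : Sym2 V → ℝ) (x : V → Bool) (M N : G.Matching) :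
    (mix x M N).weight w * (mix x N M).weight w = M.weight w * N.weight w := by
  classical
  have := Fintype.ofFinite V
  simp only [weight_eq_prod, ← Finset.prod_mul_distrib]
  refine Finset.prod_congr rfl fun e _ => ?_
  induction e with | h a b
  simp only [Subgraph.mem_edgeSet, mix_adj, union_comm N M]
  cases x (root (M.union N) a) <;> simp [mul_comm]

theorem mix_mem_conditioningEvent {S Vp Vm : Set V} (hM : M ∈ G.conditioningEvent S Vp Vm)
    (hN : N ∈ G.conditioningEvent S Vp Vm) : mix x M N ∈ G.conditioningEvent S Vp Vm := by
  simp only [conditioningEvent, Set.mem_ofPred_eq, ← Set.disjoint_iff_inter_eq_empty,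
    Set.disjoint_left, Set.subset_def] at hM hN ⊢
  refine ⟨fun a ha => ?_, fun a ha => ?_⟩ <;> rw [mem_B_mix] <;> split_ifs
  exacts [hM.1 a ha, hN.1 a ha, hM.2 ha, hN.2 ha]

theorem mix_mem_conditioningEvent_iff {S Vp Vm : Set V} :
    (mix x M N ∈ G.conditioningEvent S Vp Vm ∧ mix x N M ∈ G.conditioningEvent S Vp Vm) ↔
      M ∈ G.conditioningEvent S Vp Vm ∧ N ∈ G.conditioningEvent S Vp Vm := by
  refine ⟨fun h => ⟨?_, ?_⟩, fun h =>
    ⟨mix_mem_conditioningEvent h.1 h.2, mix_mem_conditioningEvent h.2 h.1⟩⟩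
  · rw [← mix_mix x M N]
    exact mix_mem_conditioningEvent h.1 h.2
  · rw [← mix_mix x N M]
    exact mix_mem_conditioningEvent h.2 h.1

theorem conditionedMatching_mix_mul [Finite V] {w : Sym2 V → ℝ}
    (hw : ∀ e ∈ G.edgeSet, 0 < w e) {S Vp Vm : Set V}
    (hne : (G.conditioningEvent S Vp Vm).Nonempty) (x : V → Bool) (M N : G.Matching) :
    G.conditionedMatching w hw S Vp Vm hne (mix x M N) *
        G.conditionedMatching w hw S Vp Vm hne (mix x N M) =
      G.conditionedMatching w hw S Vp Vm hne M * G.conditionedMatching w hw S Vp Vm hne N := by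
  classical
  have happly : ∀ M' N' : G.Matching, G.conditionedMatching w hw S Vp Vm hne M' *
      G.conditionedMatching w hw S Vp Vm hne N' =
      if M' ∈ G.conditioningEvent S Vp Vm ∧ N' ∈ G.conditioningEvent S Vp Vm then
        ENNReal.ofReal (M'.weight w * N'.weight w) *
          ((∑' M : G.Matching, ENNReal.ofReal (M.weight w))⁻¹ *
            (∑' M, (G.conditioningEvent S Vp Vm).indicator (G.weightedMatching w hw) M)⁻¹) ^ 2
      else 0 := by
    intro M' N'
    simp only [conditionedMatching, PMF.filter_apply]
    split_ifs with h
    · rw [Set.indicator_of_mem h.1, Set.indicator_of_mem h.2, weightedMatching,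
        PMF.normalize_apply, PMF.normalize_apply, ENNReal.ofReal_mul (weight_pos hw M').le]
      ring
    · rw [mul_eq_zero, mul_eq_zero, mul_eq_zero]
      by_cases hM' : M' ∈ G.conditioningEvent S Vp Vm
      · exact Or.inr (Or.inl (Set.indicator_of_notMem (fun hN' => h ⟨hM', hN'⟩) _))
      · exact Or.inl (Or.inl (Set.indicator_of_notMem hM' _))
  rw [happly, happly, weight_mix_mul]
  exact if_congr mix_mem_conditioningEvent_iff rfl rfl

/-- Among the mixtures of two matchings of a bipartite graph, two increasing events occur
disjointly at most as often as the first one occurs for a mixture and the second one for the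
complementary mixture. -/
theorem card_mix_disjointOccurrence_le [Fintype V] {S T : Set V} (hG : G.IsBipartiteWith S T)
    (V' : Set V) {𝒜 ℬ : Set (Set V')} (h𝒜 : IsUpperSet 𝒜)
    (hℬ : IsUpperSet ℬ) (M N : G.Matching) :
    Nat.card {x : V → Bool // (mix x M N).restrictB S V' ∈ disjointOccurrence 𝒜 ℬ} ≤
      Nat.card {x : V → Bool // (mix x M N).restrictB S V' ∈ 𝒜 ∧
        (mix x N M).restrictB S V' ∈ ℬ} := by
  classical
  have hsplit : ∀ x : V → Bool, ∃ AB : Set V' × Set V',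
      (mix x M N).restrictB S V' ∈ disjointOccurrence 𝒜 ℬ →
      AB.1 ∈ 𝒜 ∧ AB.2 ∈ ℬ ∧ AB.1 ∩ AB.2 = ∅ ∧ (mix x M N).restrictB S V' = AB.1 ∪ AB.2 := by
    intro x
    by_cases h : (mix x M N).restrictB S V' ∈ disjointOccurrence 𝒜 ℬ
    · obtain ⟨A, hA, B, hB, h1, h2⟩ := h
      exact ⟨(A, B), fun _ => ⟨hA, hB, h1, h2⟩⟩
    · exact ⟨(∅, ∅), fun h' => absurd h' h⟩
  choose AB hAB using hsplit
  -- The coins of components where a vertex of the first witness can be lost. Coordinates that are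
  -- not roots have no effect.
  let F : (V → Bool) → Finset V := fun x => Finset.univ.filter fun r =>
    ∃ v ∈ (AB x).1, (v : V) ∉ (mix x N M).B S ∧ root (M.union N) v = r
  have key := card_le_card_inter_flip
    (Finset.univ.filter fun x => (mix x M N).restrictB S V' ∈ disjointOccurrence 𝒜 ℬ) F
    (fun z => (mix z M N).restrictB S V' ∈ 𝒜) (fun z => (mix z M N).restrictB S V' ∈ ℬ) ?_ ?_
  · simpa only [Nat.card_eq_fintype_card, Fintype.card_subtype, ← mix_swap] using key
  · intro x hx z hz
    obtain ⟨hA, hB, hdis, hun⟩ := hAB x (Finset.mem_filter.1 hx).2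
    refine h𝒜 (fun v hv => ?_) hA
    have hvB : (v : V) ∈ (mix x M N).B S := (hun.ge (Or.inl hv) :)
    -- A vertex in B of both complementary mixtures lies in B of every mixture.
    by_cases hfree : (v : V) ∈ (mix x N M).B S
    · change (v : V) ∈ (mix z M N).B S
      rw [mem_B_mix] at hvB hfree ⊢
      rw [union_comm N M] at hfree
      grind
    · have := hz (root (M.union N) v) (by simpa [F] using ⟨v, ⟨v.2, hv⟩, hfree, rfl⟩)
      change (v : V) ∈ (mix z M N).B S
      rw [mem_B_mix] at hvB ⊢
      rwa [this]
  · intro x hx z hz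
    obtain ⟨hA, hB, hdis, hun⟩ := hAB x (Finset.mem_filter.1 hx).2
    refine hℬ (fun v hv => ?_) hB
    have hvB : (v : V) ∈ (mix x M N).B S := (hun.ge (Or.inr hv) :)
    by_cases hfree : (v : V) ∈ (mix x N M).B S
    · change (v : V) ∈ (mix z M N).B S
      rw [mem_B_mix] at hvB hfree ⊢
      rw [union_comm N M] at hfree
      grind
    · have := hz (root (M.union N) v) (by
        intro hmem
        obtain ⟨u, hu, hufree, hroot⟩ := (Finset.mem_filter.1 hmem).2
        have huB : (u : V) ∈ (mix x M N).B S := (hun.ge (Or.inl hu) :)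
        have huv := eq_of_reachable_union hG
          (by rw [union_mix]; exact root_eq_iff.1 hroot) huB hufree hvB hfree
        rw [Subtype.coe_injective huv] at hu
        exact (hdis.le ⟨hu, hv⟩ :))
      change (v : V) ∈ (mix z M N).B S
      rw [mem_B_mix] at hvB ⊢
      rwa [this]

end Matching

end SimpleGraph

open SimpleGraph Matching in
/-- If the product of the probabilities of two matchings is unchanged when they are mixed, then
the random set `B(M) ∩ V'` satisfies the BK inequality. -/
theorem satisfiesBK_map_restrictB {V : Type*} [Finite V] {G : SimpleGraph V} {S T : Set V}
    (hG : G.IsBipartiteWith S T) (V' : Set V) (μ : PMF G.Matching)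
    (hμ : ∀ x M N, μ (mix x M N) * μ (mix x N M) = μ M * μ N) :
    SatisfiesBK (μ.map (Matching.restrictB S V')) := by
  classical
  intro 𝒜 ℬ h𝒜 hℬ
  have := Fintype.ofFinite V
  have := Fintype.ofFinite G.Matching
  -- Every `mixEquiv x` preserves the product law, so a probability may be averaged over all `x`.
  have haverage : ∀ (Φ : G.Matching × G.Matching → Prop) [DecidablePred Φ],
      (Fintype.card (V → Bool) : ℝ≥0∞) * ∑ p, (if Φ p then μ p.1 * μ p.2 else 0) =
        ∑ p, Nat.card {x : V → Bool // Φ (mixEquiv x p)} * (μ p.1 * μ p.2) := by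
    intro Φ _
    have hx : ∀ x : V → Bool, ∑ p, (if Φ p then μ p.1 * μ p.2 else 0) =
        ∑ p, if Φ (mixEquiv x p) then μ p.1 * μ p.2 else 0 := by
      intro x
      rw [← Equiv.sum_comp (mixEquiv x)]
      refine Finset.sum_congr rfl fun p _ => ?_
      rw [show μ (mixEquiv x p).1 * μ (mixEquiv x p).2 = μ p.1 * μ p.2 from hμ x p.1 p.2]
    rw [← nsmul_eq_mul, Fintype.card, ← Finset.sum_const, Finset.sum_congr rfl fun x _ => hx x,
      Finset.sum_comm]
    refine Finset.sum_congr rfl fun p _ => ?_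
    rw [← Finset.sum_filter, Finset.sum_const, nsmul_eq_mul, Nat.card_eq_fintype_card,
      Fintype.card_subtype]
  have hleft : (μ.map (Matching.restrictB S V')).toOuterMeasure (disjointOccurrence 𝒜 ℬ) =
      ∑ p : G.Matching × G.Matching,
        if p.1.restrictB S V' ∈ disjointOccurrence 𝒜 ℬ then μ p.1 * μ p.2 else 0 := by
    have hone : ∑ N, μ N = 1 := (tsum_fintype _).symm.trans μ.tsum_coe
    rw [PMF.toOuterMeasure_map_apply, PMF.toOuterMeasure_apply_fintype, Fintype.sum_prod_type]
    refine Finset.sum_congr rfl fun M _ => ?_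
    rw [Set.indicator_apply, Set.mem_preimage]
    split_ifs
    · dsimp only
      rw [← Finset.mul_sum, hone, mul_one]
    · simp
  have hright : (μ.map (Matching.restrictB S V')).toOuterMeasure 𝒜 *
      (μ.map (Matching.restrictB S V')).toOuterMeasure ℬ = ∑ p : G.Matching × G.Matching,
        if p.1.restrictB S V' ∈ 𝒜 ∧ p.2.restrictB S V' ∈ ℬ then μ p.1 * μ p.2 else 0 := by
    rw [PMF.toOuterMeasure_map_apply, PMF.toOuterMeasure_map_apply,
      PMF.toOuterMeasure_apply_fintype, PMF.toOuterMeasure_apply_fintype, Finset.sum_mul_sum,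
      Fintype.sum_prod_type]
    refine Finset.sum_congr rfl fun M _ => Finset.sum_congr rfl fun N _ => ?_
    simp only [Set.indicator_apply, Set.mem_preimage]
    split_ifs <;> simp_all
  rw [hright, hleft, ← ENNReal.mul_le_mul_iff_right (a := (Fintype.card (V → Bool) : ℝ≥0∞))
    (by simp) (ENNReal.natCast_ne_top _), haverage,
    haverage fun p => p.1.restrictB S V' ∈ 𝒜 ∧ p.2.restrictB S V' ∈ ℬ]
  refine Finset.sum_le_sum fun p _ => ?_
  gcongr
  exact card_mix_disjointOccurrence_le hG V' h𝒜 hℬ p.1 p.2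

theorem theorem3 {V : Type*} [Finite V] (G : SimpleGraph V) (S T : Set V)
    (hG : G.IsBipartiteWith S T) (hST : S ∪ T = Set.univ)
    (w : Sym2 V → ℝ) (hw : ∀ e ∈ G.edgeSet, 0 < w e)
    (Vp Vm : Set V) (hdisj : Disjoint Vp Vm)
    (hne : (G.conditioningEvent S Vp Vm).Nonempty) :
    SatisfiesBK ((G.conditionedMatching w hw S Vp Vm hne).map
      (SimpleGraph.Matching.restrictB S (Vp ∪ Vm)ᶜ)) :=
  satisfiesBK_map_restrictB hG _ _ fun x M N =>
    SimpleGraph.Matching.conditionedMatching_mix_mul hw hne x M N
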